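/- For $x>0$ let $$\theta_2(x)=\sum_{k\in\mathbb Z}e^{-\pi(k+1/2)^2x},\qquad \theta_3(x)=\sum_{k\in\mathbb Z}e^{-\pi k^2x},\qquad \theta_4(x)=\sum_{k\in\mathbb Z}(-1)^ke^{-\pi k^2x},$$ and for $S\subset\mathbb R^d$ and $\alpha>0$ let $\theta_S(\alpha)=\sum_{p\in S}e^{-\pi\alpha|p|^2}$. Theorem 1.4. Let $d\ge 1$, $\alpha>0$, and let $c_1,\dots,c_d>0$ satisfy $\prod_{i=1}^d c_i=1$ and not all be equal to $1$. For $t\in\mathbb R$ put $A_t=\mathrm{diag}(c_1^{t/2},\dots,c_d^{t/2})$, $U_j(t)=\prod_{i=1}^d\theta_j(c_i^t\alpha)$ for $j=2,3,4$, and $$Q(t)=\prod_{i=1}^d\frac{\theta_2(c_i^t\alpha)}{\theta_3(c_i^t\alpha)},\quad P_{3,4}(t)=\prod_{i=1}^d\theta_3(c_i^t\alpha)\theta_4(c_i^t\alpha),\quad P_{2,3}(t)=\prod_{i=1}^d\theta_2(c_i^t\alpha)\theta_3(c_i^t\alpha).$$ Then for every $t\in\mathbb R$ $$U_2(t)=\theta_{A_t(\mathbb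 Z+1/2)^d}(\alpha),\quad \theta_{A_t\mathbb Z^d}(\alpha)\neq 0,\quad Q(t)=\frac{\theta_{A_t(\mathbb Z+1/2)^d}(\alpha)}{\theta_{A_t\mathbb Z^d}(\alpha)},\quad P_{3,4}=U_3U_4,\quad P_{2,3}=U_2U_3 .$$ Moreover, every $f\in\{U_4,U_2,Q,P_{3,4},P_{2,3}\}$ is differentiable on $\mathbb R$ and satisfies 1. $f'(0)=0$, 2. $f'(t)>0$ for all $t<0$, 3. $f'(t)<0$ for all $t>0$. In particular $t=0$ is the only strict maximum of $f$: $f(t)<f(0)$ for all $t\ne 0$, and $f$ has no local maximum at any other point. -/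

import Mathlib

open Real

noncomputable section

namespace ThetaProducts

/-- The theta value `θ₂(x) = ∑_{k ∈ ℤ} e^{-π (k + 1/2)² x}`. -/
def theta2 (x : ℝ) : ℝ := ∑' k : ℤ, exp (-π * ((k : ℝ) + 1 / 2) ^ 2 * x)

/-- The theta value `θ₃(x) = ∑_{k ∈ ℤ} e^{-π k² x}`. -/
def theta3 (x : ℝ) : ℝ := ∑' k : ℤ, exp (-π * (k : ℝ) ^ 2 * x)

/-- The theta value `θ₄(x) = ∑_{k ∈ ℤ} (-1)^k e^{-π k² x}`. -/
def theta4 (x : ℝ) : ℝ := ∑' k : ℤ, (-1 : ℝ) ^ k * exp (-π * (k : ℝ) ^ 2 * x)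

/-- The theta function `θ_S(α) = ∑_{p ∈ S} e^{-π α |p|²}` of a point configuration `S ⊆ ℝᵈ`. -/
def thetaSet {d : ℕ} (S : Set (EuclideanSpace ℝ (Fin d))) (α : ℝ) : ℝ :=
  ∑' p : S, exp (-π * α * ‖(p : EuclideanSpace ℝ (Fin d))‖ ^ 2)

/-- The cubic lattice `ℤᵈ` in `ℝᵈ`. -/
def cubic (d : ℕ) : Set (EuclideanSpace ℝ (Fin d)) :=
  {x | ∀ i, ∃ k : ℤ, x i = k}

/-- The translated cubic lattice `(ℤ + 1/2)ᵈ` in `ℝᵈ`. -/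
def cubicShift (d : ℕ) : Set (EuclideanSpace ℝ (Fin d)) :=
  {x | ∀ i, ∃ k : ℤ, x i = k + 1 / 2}

/-- The linear map of `ℝᵈ` with matrix `A_t = diag(c₁^{t/2}, …, c_d^{t/2})`. -/
def stretch {d : ℕ} (c : Fin d → ℝ) (t : ℝ) :
    EuclideanSpace ℝ (Fin d) →ₗ[ℝ] EuclideanSpace ℝ (Fin d) :=
  Matrix.toEuclideanLin (Matrix.diagonal fun i => c i ^ (t / 2))

variable {d : ℕ} (c : Fin d → ℝ) (α : ℝ)

def U2 (t : ℝ) : ℝ := ∏ i, theta2 (c i ^ t * α)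

def U3 (t : ℝ) : ℝ := ∏ i, theta3 (c i ^ t * α)

def U4 (t : ℝ) : ℝ := ∏ i, theta4 (c i ^ t * α)

def Q (t : ℝ) : ℝ := ∏ i, theta2 (c i ^ t * α) / theta3 (c i ^ t * α)

def P34 (t : ℝ) : ℝ := ∏ i, theta3 (c i ^ t * α) * theta4 (c i ^ t * α)

def P23 (t : ℝ) : ℝ := ∏ i, theta2 (c i ^ t * α) * theta3 (c i ^ t * α)

end ThetaProducts

end

/-!
Put `h u = log (g (exp u))` for `g` one of `θ₄`, `θ₂`, `θ₂ / θ₃`, `θ₃ θ₄`, `θ₂ θ₃`, and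
`λ i = log (c i)`, so that `∑ i, λ i = 0`. Then `f t = ∏ i, g (c i ^ t * α)` has logarithmic
derivative `∑ i, λ i * h' (t * λ i + log α)`, which is also
`∑ i, λ i * (h' (t * λ i + log α) - h' (log α))`. If `h` is strictly concave, `h'` is strictly
decreasing, every summand with `λ i ≠ 0` has the sign of `-t`, and all claims about `f` follow
(`StrictLogConcaveExp.prod_maximal`).

It remains to see that `h` is strictly concave. With `q = exp (-π x)`, the Jacobi product formulas
write `θ₄`, `θ₃ θ₄` and `θ₄ / θ₃` as infinite products of factors `1 - q ^ n` in the first two cases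
and `((1 - q ^ n) / (1 + q ^ n)) ^ 2` in the third. For `y = n π x` the logarithms of
`1 - exp (-y)` and of `(1 - exp (-y)) / (1 + exp (-y))` have derivatives `y / (exp y - 1)` and
`y / sinh y` in the variable `log y`, which are strictly decreasing; so each factor is strictly
log-concave in `u = log x`, and a convergent sum of strictly concave functions is strictly concave.
The modular transformations `θ₂(x) = x^{-1/2} θ₄(1/x)` and `θ₃(x) = x^{-1/2} θ₃(1/x)` carry `θ₄`,
`θ₄ / θ₃` and `θ₃ θ₄` to `θ₂`, `θ₂ / θ₃` and `θ₂ θ₃`, up to a power of `x`, which changes `h` by a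
linear term only.

The product formulas are the Jacobi triple product at `z = ±1`
(`tendsto_prod_tripleProduct`), obtained from the finite `q`-binomial theorem by dominated
convergence.
-/

namespace ThetaProducts

open Filter Topology HurwitzZeta

/-! ### The Jacobi triple product at `±1` -/

/-- The `q`-factorial `∏_{m=1}^n (1 - p^m)`, the finite `q`-Pochhammer symbol `(p; p)_n`. -/
def qFac (p : ℝ) (n : ℕ) : ℝ := ∏ m ∈ Finset.range n, (1 - p ^ (m + 1))

/-- The Gaussian binomial coefficient, defined by the `q`-Pascal rule, so that it vanishes
when the lower index exceeds the upper one. -/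
def gaussBinom (p : ℝ) : ℕ → ℕ → ℝ
  | _, 0 => 1
  | 0, _ + 1 => 0
  | n + 1, i + 1 => gaussBinom p n i + p ^ (i + 1) * gaussBinom p n (i + 1)

lemma gaussBinom_zero_right (p : ℝ) (n : ℕ) : gaussBinom p n 0 = 1 := by
  cases n <;> simp [gaussBinom]

lemma gaussBinom_eq_zero (p : ℝ) {n i : ℕ} (h : n < i) : gaussBinom p n i = 0 := by
  induction n generalizing i with
  | zero => obtain ⟨i, rfl⟩ := Nat.exists_eq_succ_of_ne_zero h.ne'; simp [gaussBinom]
  | succ n ih =>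
    obtain ⟨i, rfl⟩ := Nat.exists_eq_succ_of_ne_zero (Nat.ne_zero_of_lt h)
    rw [Nat.succ_eq_add_one, gaussBinom, ih (by omega), ih (by omega)]
    simp

lemma gaussBinom_self (p : ℝ) (n : ℕ) : gaussBinom p n n = 1 := by
  induction n with
  | zero => simp [gaussBinom]
  | succ n ih => rw [gaussBinom, ih, gaussBinom_eq_zero p (Nat.lt_succ_self n)]; simp

lemma qFac_succ (p : ℝ) (n : ℕ) : qFac p (n + 1) = qFac p n * (1 - p ^ (n + 1)) := by
  simp [qFac, Finset.prod_range_succ]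

lemma gaussBinom_mul_qFac (p : ℝ) (i j : ℕ) :
    gaussBinom p (i + j) i * (qFac p i * qFac p j) = qFac p (i + j) := by
  suffices ∀ n i j, i + j = n →
      gaussBinom p (i + j) i * (qFac p i * qFac p j) = qFac p (i + j) from this _ i j rfl
  intro n
  induction n with
  | zero =>
    intro i j h
    obtain ⟨rfl, rfl⟩ : i = 0 ∧ j = 0 := by omega
    simp [gaussBinom, qFac]
  | succ n ih =>
    intro i j h
    rcases i with _ | i
    · simp [gaussBinom_zero_right, qFac]
    rcases j with _ | j
    · rw [add_zero, gaussBinom_self]; simp [qFac]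
    have h1 := ih i (j + 1) (by omega)
    have h2 := ih (i + 1) j (by omega)
    have e1 : i + 1 + (j + 1) = (i + (j + 1)) + 1 := by omega
    have e2 : i + 1 + j = i + (j + 1) := by omega
    rw [e2] at h2
    rw [e1, gaussBinom, qFac_succ p (i + (j + 1))]
    rw [qFac_succ p i] at h2 ⊢
    rw [qFac_succ p j] at h1 ⊢
    have e3 : p ^ (i + (j + 1) + 1) = p ^ (i + 1) * p ^ (j + 1) := by ring
    rw [e3]
    linear_combination (1 - p ^ (i + 1)) * h1 + p ^ (i + 1) * (1 - p ^ (j + 1)) * h2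

/-- The `q`-binomial theorem, in the normalisation in which the coefficients carry `q ^ i²`. -/
lemma prod_one_add_mul_pow (q y : ℝ) (M : ℕ) :
    ∏ k ∈ Finset.range M, (1 + y * q ^ (2 * k + 1)) =
      ∑ i ∈ Finset.range (M + 1), q ^ (i ^ 2) * gaussBinom (q ^ 2) M i * y ^ i := by
  induction M generalizing y with
  | zero => simp [gaussBinom]
  | succ M ih =>
    have h := ih (y * q ^ 2)
    have e : ∏ k ∈ Finset.range M, (1 + y * q ^ (2 * (k + 1) + 1)) =
        ∏ k ∈ Finset.range M, (1 + y * q ^ 2 * q ^ (2 * k + 1)) :=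
      Finset.prod_congr rfl fun k _ ↦ by ring
    rw [Finset.prod_range_succ', e, h, Finset.sum_range_succ' _ (M + 1)]
    have h3 : ∑ i ∈ Finset.range (M + 1), q ^ ((i + 1) ^ 2) *
        gaussBinom (q ^ 2) (M + 1) (i + 1) * y ^ (i + 1) =
        (∑ i ∈ Finset.range (M + 1), q ^ (i ^ 2) * gaussBinom (q ^ 2) M i * (y * q ^ 2) ^ i)
          * (y * q) + ∑ i ∈ Finset.range (M + 1), q ^ ((i + 1) ^ 2) *
            gaussBinom (q ^ 2) M (i + 1) * (y * q ^ 2) ^ (i + 1) := by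
      rw [Finset.sum_mul, ← Finset.sum_add_distrib]
      refine Finset.sum_congr rfl fun i _ ↦ ?_
      rw [gaussBinom]
      ring
    have h4 := Finset.sum_range_succ' (fun i ↦ q ^ (i ^ 2) * gaussBinom (q ^ 2) M i *
      (y * q ^ 2) ^ i) (M + 1)
    rw [Finset.sum_range_succ, gaussBinom_eq_zero _ (Nat.lt_succ_self M)] at h4
    simp only [gaussBinom_zero_right, mul_zero, zero_mul, add_zero, pow_zero, mul_one] at h4 ⊢
    rw [h3]
    linear_combination h4

/-- The finite form of the Jacobi triple product, at a point `z = ±1`. -/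
lemma prod_sq_eq_sum_gaussBinom {q z : ℝ} (hq : q ≠ 0) (hz : z ^ 2 = 1) (N : ℕ) :
    ∏ m ∈ Finset.range N, (1 + z * q ^ (2 * m + 1)) ^ 2 =
      ∑ i ∈ Finset.range (2 * N + 1),
        z ^ ((i : ℤ) - N) * q ^ (((i : ℤ) - N) ^ 2) * gaussBinom (q ^ 2) (2 * N) i := by
  have hz0 : z ≠ 0 := by rintro rfl; norm_num at hz
  have hfirst : ∀ N : ℕ, ∏ k ∈ Finset.range N, (1 + z * (q ^ (2 * k + 1))⁻¹) =
      z ^ N * (q ^ (N ^ 2))⁻¹ * ∏ k ∈ Finset.range N, (1 + z * q ^ (2 * k + 1)) := by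
    intro N
    induction N with
    | zero => simp
    | succ N ih =>
      rw [Finset.prod_range_succ, ih, Finset.prod_range_succ]
      have : q ^ ((N + 1) ^ 2) = q ^ (N ^ 2) * q ^ (2 * N + 1) := by ring
      rw [this]
      field_simp
      linear_combination (-(z ^ N * ∏ x ∈ Finset.range N, (1 + z * q ^ (2 * x + 1))) *
        q ^ (2 * N + 1)) * hz
  -- With `2N` factors and `y = z q^{-2N}`, the exponents `2k + 1 - 2N` run symmetrically through
  -- the odd integers from `1 - 2N` to `2N - 1`.
  have key := prod_one_add_mul_pow q (z * (q ^ (2 * N))⁻¹) (2 * N)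
  rw [two_mul N, Finset.prod_range_add, ← Finset.prod_range_reflect, ← two_mul] at key
  have e1 : ∏ j ∈ Finset.range N, (1 + z * (q ^ (2 * N))⁻¹ * q ^ (2 * (N - 1 - j) + 1)) =
      ∏ k ∈ Finset.range N, (1 + z * (q ^ (2 * k + 1))⁻¹) := by
    refine Finset.prod_congr rfl fun k hk ↦ ?_
    have hk := Finset.mem_range.1 hk
    have : q ^ (2 * N) = q ^ (2 * (N - 1 - k) + 1) * q ^ (2 * k + 1) := by
      rw [← pow_add]; congr 1; omega
    rw [this]
    field_simp
  have e2 : ∏ j ∈ Finset.range N, (1 + z * (q ^ (2 * N))⁻¹ * q ^ (2 * (N + j) + 1)) =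
      ∏ k ∈ Finset.range N, (1 + z * q ^ (2 * k + 1)) := by
    refine Finset.prod_congr rfl fun k hk ↦ ?_
    have : q ^ (2 * (N + k) + 1) = q ^ (2 * N) * q ^ (2 * k + 1) := by ring
    rw [this]
    field_simp
  rw [e1, e2, hfirst] at key
  rw [Finset.prod_pow, sq (∏ m ∈ Finset.range N, _)]
  have hzN : z ^ N * z ^ N = 1 := by rw [← mul_pow, ← sq, hz, one_pow]
  have hA : (q ^ (N ^ 2)) ≠ 0 := pow_ne_zero _ hq
  calc _ = z ^ N * q ^ (N ^ 2) * (z ^ N * (q ^ N ^ 2)⁻¹ *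
        (∏ k ∈ Finset.range N, (1 + z * q ^ (2 * k + 1))) *
        ∏ k ∈ Finset.range N, (1 + z * q ^ (2 * k + 1))) := by
        field_simp
        rw [sq (z ^ N), hzN, mul_one]
    _ = _ := by
        rw [key, Finset.mul_sum]
        refine Finset.sum_congr rfl fun i _ ↦ ?_
        have hzi : z ^ ((i : ℤ) - N) = z ^ N * z ^ i := by
          rw [zpow_sub₀ hz0, zpow_natCast, zpow_natCast, div_eq_iff (pow_ne_zero _ hz0)]
          linear_combination (-z ^ i) * hzN
        have hqi : q ^ (((i : ℤ) - N) ^ 2) = q ^ (N ^ 2) * q ^ (i ^ 2) * ((q ^ (2 * N))⁻¹) ^ i := by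
          have : ((i : ℤ) - N) ^ 2 = ((N ^ 2 + i ^ 2 : ℕ) : ℤ) - ((2 * N * i : ℕ) : ℤ) := by
            push_cast; ring
          rw [this, zpow_sub₀ hq, zpow_natCast, zpow_natCast, inv_pow, ← pow_mul, ← pow_add,
            div_eq_mul_inv]
        rw [hzi, hqi, mul_pow]
        ring

section Limit

variable {p : ℝ}

lemma qFac_pos (h0 : 0 < p) (h1 : p < 1) (n : ℕ) : 0 < qFac p n :=
  Finset.prod_pos fun m _ ↦ sub_pos.2 (pow_lt_one₀ h0.le h1 (Nat.succ_ne_zero m))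

lemma qFac_antitone (h0 : 0 < p) (h1 : p < 1) : Antitone (qFac p) := by
  refine antitone_nat_of_succ_le fun n ↦ ?_
  rw [qFac_succ]
  exact mul_le_of_le_one_right (qFac_pos h0 h1 n).le (by have := pow_pos h0 (n + 1); linarith)

lemma exists_tendsto_qFac (h0 : 0 < p) (h1 : p < 1) :
    ∃ E > 0, Tendsto (qFac p) atTop (𝓝 E) := by
  have hs : Summable fun m : ℕ ↦ -p ^ (m + 1) :=
    ((summable_nat_add_iff 1).2 (summable_geometric_of_lt_one h0.le h1)).neg
  have hm := Real.multipliable_one_add_of_summable hs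
  have ht : Tendsto (qFac p) atTop (𝓝 (∏' m : ℕ, (1 + -p ^ (m + 1)))) := by
    refine hm.hasProd.tendsto_prod_nat.congr fun n ↦ ?_
    simp [qFac, sub_eq_add_neg]
  refine ⟨_, lt_of_le_of_ne (ge_of_tendsto' ht fun n ↦ (qFac_pos h0 h1 n).le) (Ne.symm ?_), ht⟩
  refine tprod_one_add_ne_zero_of_summable (fun i ↦ ?_) hs.norm
  rw [← sub_eq_add_neg]
  exact (sub_pos.2 (pow_lt_one₀ h0.le h1 (Nat.succ_ne_zero i))).ne'

/-- The Gaussian binomial coefficient `[2N, N + j]` for an integer offset `j`, extended by zero. -/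
def centralGauss (p : ℝ) (N : ℕ) (j : ℤ) : ℝ :=
  if -(N : ℤ) ≤ j then gaussBinom p (2 * N) (j + N).toNat else 0

lemma centralGauss_eq_div (h0 : 0 < p) (h1 : p < 1) {N : ℕ} {j : ℤ} (hj : |j| ≤ N) :
    centralGauss p N j = qFac p (2 * N) / (qFac p (j + N).toNat * qFac p (N - j).toNat) := by
  obtain ⟨ha, hb⟩ := abs_le.1 hj
  have e : (j + N).toNat + (N - j).toNat = 2 * N := by omega
  rw [centralGauss, if_pos ha, eq_div_iff (mul_pos (qFac_pos h0 h1 _) (qFac_pos h0 h1 _)).ne', ← e,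
    gaussBinom_mul_qFac]

lemma centralGauss_eq_zero {N : ℕ} {j : ℤ} (hj : ¬ |j| ≤ N) : centralGauss p N j = 0 := by
  rw [centralGauss]
  split_ifs with h
  · refine gaussBinom_eq_zero _ ?_
    rw [abs_le] at hj
    omega
  · rfl

lemma tendsto_centralGauss (h0 : 0 < p) (h1 : p < 1) {E : ℝ} (hE : 0 < E)
    (hlim : Tendsto (qFac p) atTop (𝓝 E)) (j : ℤ) :
    Tendsto (fun N : ℕ ↦ centralGauss p N j) atTop (𝓝 E⁻¹) := by
  have t1 : Tendsto (fun N : ℕ ↦ 2 * N) atTop atTop :=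
    tendsto_atTop.2 fun b ↦ (eventually_ge_atTop b).mono fun N h ↦ by omega
  have t2 : Tendsto (fun N : ℕ ↦ (j + N).toNat) atTop atTop :=
    tendsto_atTop.2 fun b ↦ (eventually_ge_atTop (b + j.natAbs)).mono fun N h ↦ by omega
  have t3 : Tendsto (fun N : ℕ ↦ (N - j).toNat) atTop atTop :=
    tendsto_atTop.2 fun b ↦ (eventually_ge_atTop (b + j.natAbs)).mono fun N h ↦ by omega
  have := (hlim.comp t1).div ((hlim.comp t2).mul (hlim.comp t3)) (mul_pos hE hE).ne'
  rw [show E / (E * E) = E⁻¹ by field_simp] at this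
  refine this.congr' ((eventually_ge_atTop j.natAbs).mono fun N h ↦ ?_)
  exact (centralGauss_eq_div h0 h1 (by rw [Int.abs_eq_natAbs]; exact_mod_cast h)).symm

lemma abs_centralGauss_le (h0 : 0 < p) (h1 : p < 1) {E : ℝ} (hE : 0 < E)
    (hlim : Tendsto (qFac p) atTop (𝓝 E)) (N : ℕ) (j : ℤ) :
    |centralGauss p N j| ≤ (E * E)⁻¹ := by
  by_cases hj : |j| ≤ N
  · have hle (n : ℕ) : E ≤ qFac p n := (qFac_antitone h0 h1).le_of_tendsto hlim n
    rw [centralGauss_eq_div h0 h1 hj, abs_of_nonneg (div_nonneg (qFac_pos h0 h1 _).le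
      (mul_pos (qFac_pos h0 h1 _) (qFac_pos h0 h1 _)).le), ← one_div]
    have h2 : qFac p (2 * N) ≤ 1 := by
      simpa [qFac] using qFac_antitone h0 h1 (Nat.zero_le (2 * N))
    exact div_le_div₀ zero_le_one h2 (mul_pos hE hE)
      (mul_le_mul (hle _) (hle _) hE.le (qFac_pos h0 h1 _).le)
  · rw [centralGauss_eq_zero hj, abs_zero]
    positivity

/-- The Jacobi triple product at a point `z = ±1`, the product being the limit of its partial
products. -/
lemma tendsto_prod_tripleProduct {q z : ℝ} (hq0 : 0 < q) (hq1 : q < 1) (hz : z ^ 2 = 1)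
    (hs : Summable fun j : ℤ ↦ q ^ (j ^ 2)) :
    Tendsto (fun N ↦ ∏ m ∈ Finset.range N, ((1 - (q ^ 2) ^ (m + 1)) * (1 + z * q ^ (2 * m + 1)) ^ 2))
      atTop (𝓝 (∑' j : ℤ, z ^ j * q ^ (j ^ 2))) := by
  have hp0 : 0 < q ^ 2 := by positivity
  have hp1 : q ^ 2 < 1 := pow_lt_one₀ hq0.le hq1 two_ne_zero
  obtain ⟨E, hE, hlim⟩ := exists_tendsto_qFac hp0 hp1
  have habs : ∀ j : ℤ, |z ^ j| = 1 := by
    intro j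
    have : |z| = 1 := by rw [← sq_eq_sq₀ (abs_nonneg z) zero_le_one, sq_abs, hz, one_pow]
    rw [abs_zpow, this, one_zpow]
  have hfin : ∀ N : ℕ, ∏ m ∈ Finset.range N, (1 + z * q ^ (2 * m + 1)) ^ 2 =
      ∑' j : ℤ, z ^ j * q ^ (j ^ 2) * centralGauss (q ^ 2) N j := by
    intro N
    rw [prod_sq_eq_sum_gaussBinom hq0.ne' hz,
      tsum_eq_sum (s := (Finset.range (2 * N + 1)).image fun i : ℕ ↦ (i : ℤ) - N),
      Finset.sum_image]
    · refine Finset.sum_congr rfl fun i _ ↦ ?_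
      rw [centralGauss, if_pos (by omega)]
      simp
    · intro a _ b _ h
      simpa using h
    · intro j hj
      rw [centralGauss_eq_zero, mul_zero]
      intro h
      rw [abs_le] at h
      exact hj (Finset.mem_image.2 ⟨(j + N).toNat, Finset.mem_range.2 (by omega), by omega⟩)
  have hT : Tendsto (fun N : ℕ ↦ ∑' j : ℤ, z ^ j * q ^ (j ^ 2) * centralGauss (q ^ 2) N j) atTop
      (𝓝 (∑' j : ℤ, z ^ j * q ^ (j ^ 2) * E⁻¹)) := by
    refine tendsto_tsum_of_dominated_convergence (hs.mul_right (E * E)⁻¹)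
      (fun j ↦ (tendsto_centralGauss hp0 hp1 hE hlim j).const_mul _) (.of_forall fun N j ↦ ?_)
    rw [Real.norm_eq_abs, abs_mul, abs_mul, habs, one_mul, abs_of_pos (zpow_pos hq0 _)]
    gcongr
    exact abs_centralGauss_le hp0 hp1 hE hlim N j
  have := hlim.mul hT
  rw [tsum_mul_right, mul_comm, mul_assoc, inv_mul_cancel₀ hE.ne', mul_one] at this
  refine this.congr fun N ↦ ?_
  rw [← hfin, qFac, Finset.prod_mul_distrib]

end Limit

/-! ### Strict concavity in the multiplicative variable -/

lemma strictAntiOn_div_exp_sub_one : StrictAntiOn (fun y : ℝ ↦ y / (exp y - 1)) (Set.Ioi 0) := by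
  intro x hx y hy hxy
  have hx : 0 < x := hx
  have hy : 0 < y := hy
  have h := strictConvexOn_exp.secant_strict_mono (Set.mem_univ 0) (Set.mem_univ x)
    (Set.mem_univ y) hx.ne' hy.ne' hxy
  simp only [exp_zero, sub_zero] at h
  have h1 : 0 < (exp x - 1) / x := div_pos (by linarith [add_one_lt_exp hx.ne']) hx
  have := one_div_lt_one_div_of_lt h1 h
  simpa only [one_div_div] using this

lemma strictAntiOn_div_sinh : StrictAntiOn (fun y : ℝ ↦ y / sinh y) (Set.Ioi 0) := by
  have hconv : StrictConvexOn ℝ (Set.Ici 0) sinh := by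
    refine StrictMonoOn.strictConvexOn_of_deriv (convex_Ici 0) continuous_sinh.continuousOn ?_
    rw [Real.deriv_sinh]
    exact cosh_strictMonoOn.mono interior_subset
  intro x hx y hy hxy
  have hx : 0 < x := hx
  have hy : 0 < y := hy
  have h := hconv.secant_strict_mono Set.self_mem_Ici hx.le hy.le hx.ne' hy.ne' hxy
  simp only [sinh_zero, sub_zero] at h
  have h1 : 0 < sinh x / x := div_pos (sinh_pos_iff.2 hx) hx
  have := one_div_lt_one_div_of_lt h1 h
  simpa only [one_div_div] using this

/-- If `y * φ' y` is strictly decreasing on `(0, ∞)`, then `u ↦ φ (a * exp u)` is strictly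
concave. -/
lemma strictConcaveOn_comp_mul_exp {φ ψ : ℝ → ℝ} (hφ : ∀ y > 0, HasDerivAt φ (ψ y / y) y)
    (hψ : StrictAntiOn ψ (Set.Ioi 0)) {a : ℝ} (ha : 0 < a) :
    StrictConcaveOn ℝ Set.univ fun u ↦ φ (a * exp u) := by
  have hd (u : ℝ) : HasDerivAt (fun u ↦ φ (a * exp u)) (ψ (a * exp u)) u := by
    have hpos : 0 < a * exp u := by positivity
    have := (hφ _ hpos).comp u ((Real.hasDerivAt_exp u).const_mul a)
    rwa [div_mul_cancel₀ _ hpos.ne'] at this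
  refine StrictAnti.strictConcaveOn_univ_of_deriv
    (continuous_iff_continuousAt.2 fun u ↦ (hd u).continuousAt) ?_
  rw [show deriv (fun u ↦ φ (a * exp u)) = fun u ↦ ψ (a * exp u) from funext fun u ↦ (hd u).deriv]
  intro u v huv
  refine hψ (Set.mem_Ioi.2 (by positivity)) (Set.mem_Ioi.2 (by positivity)) ?_
  gcongr

lemma strictConcaveOn_log_one_sub_exp {a : ℝ} (ha : 0 < a) :
    StrictConcaveOn ℝ Set.univ fun u ↦ log (1 - exp (-(a * exp u))) := by
  refine strictConcaveOn_comp_mul_exp (φ := fun y ↦ log (1 - exp (-y))) (fun y hy ↦ ?_)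
    strictAntiOn_div_exp_sub_one ha
  have h1 : exp (-y) < 1 := exp_lt_one_iff.2 (by linarith)
  have h2 : 1 < exp y := one_lt_exp_iff.2 hy
  have := (((hasDerivAt_id' y).fun_neg.exp).const_sub 1).log (sub_pos.2 h1).ne'
  convert this using 1
  rw [exp_neg] at h1 ⊢
  have h3 : exp y - 1 ≠ 0 := by linarith
  field_simp

/-- Here `(1 - e^{-y}) / (1 + e^{-y}) = tanh (y / 2)`, whose logarithmic derivative is
`1 / sinh y`. -/
lemma strictConcaveOn_log_tanh {a : ℝ} (ha : 0 < a) :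
    StrictConcaveOn ℝ Set.univ
      fun u ↦ log (1 - exp (-(a * exp u))) - log (1 + exp (-(a * exp u))) := by
  refine strictConcaveOn_comp_mul_exp (φ := fun y ↦ log (1 - exp (-y)) - log (1 + exp (-y)))
    (fun y hy ↦ ?_) strictAntiOn_div_sinh ha
  have h1 : exp (-y) < 1 := exp_lt_one_iff.2 (by linarith)
  have h2 : 1 < exp y := one_lt_exp_iff.2 hy
  have h0 := exp_pos (-y)
  have := ((((hasDerivAt_id' y).fun_neg.exp).const_sub 1).log (sub_pos.2 h1).ne').sub
    ((((hasDerivAt_id' y).fun_neg.exp).const_add 1).log (by positivity))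
  refine this.congr_deriv ?_
  rw [sinh_eq]
  rw [exp_neg] at h1 h0 ⊢
  have h3 : exp y - 1 ≠ 0 := by linarith
  have h4 : exp y ^ 2 - 1 ≠ 0 := by nlinarith
  field_simp
  ring

/-- A pointwise convergent series of strictly concave functions has a strictly concave sum. -/
lemma strictConcaveOn_of_tendsto_sum {f : ℕ → ℝ → ℝ} {F : ℝ → ℝ}
    (hf : ∀ n, StrictConcaveOn ℝ Set.univ (f n))
    (hlim : ∀ u, Tendsto (fun N ↦ ∑ n ∈ Finset.range N, f n u) atTop (𝓝 (F u))) :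
    StrictConcaveOn ℝ Set.univ F := by
  refine ⟨convex_univ, fun x _ y _ hxy a b ha hb hab ↦ ?_⟩
  -- The gap of the first summand survives in the limit.
  have h0 := (hf 0).2 (Set.mem_univ x) (Set.mem_univ y) hxy ha hb hab
  set g : ℝ := f 0 (a • x + b • y) - (a • f 0 x + b • f 0 y)
  have hg : 0 < g := sub_pos.2 h0
  suffices a • F x + b • F y + g ≤ F (a • x + b • y) by linarith
  refine le_of_tendsto_of_tendsto ((((hlim x).const_smul a).add ((hlim y).const_smul b)).add_const g)
    (hlim _) ((eventually_ge_atTop 1).mono fun N hN ↦ ?_)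
  obtain ⟨N, rfl⟩ := Nat.exists_eq_add_of_le' hN
  have hsum : ∑ n ∈ Finset.range N, (a • f (n + 1) x + b • f (n + 1) y) ≤
      ∑ n ∈ Finset.range N, f (n + 1) (a • x + b • y) :=
    Finset.sum_le_sum fun n _ ↦ ((hf (n + 1)).2 (Set.mem_univ x) (Set.mem_univ y) hxy ha hb hab).le
  rw [Finset.sum_add_distrib, ← Finset.smul_sum, ← Finset.smul_sum] at hsum
  simp only [Finset.sum_range_succ', smul_add]
  simp only [g]
  linarith

/-! ### Products over stretched arguments -/

/-- The functions whose products over multiplicative dilations are shown to be maximal at the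
unstretched configuration: positive, differentiable functions on `(0, ∞)` whose logarithm is
strictly concave in the multiplicative variable, that is, `u ↦ log (g (exp u))` is strictly
concave. -/
structure StrictLogConcaveExp (g : ℝ → ℝ) : Prop where
  pos : ∀ x > 0, 0 < g x
  differentiableAt : ∀ x > 0, DifferentiableAt ℝ g x
  strictConcave : StrictConcaveOn ℝ Set.univ fun u ↦ log (g (exp u))

lemma StrictLogConcaveExp.congr {g k : ℝ → ℝ} (hg : StrictLogConcaveExp g)
    (h : ∀ x > 0, k x = g x) : StrictLogConcaveExp k where
  pos x hx := by rw [h x hx]; exact hg.pos x hx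
  differentiableAt x hx := (hg.differentiableAt x hx).congr_of_eventuallyEq
    ((lt_mem_nhds hx).mono fun y hy ↦ h y hy)
  strictConcave := by
    convert hg.strictConcave using 3 with u
    exact h _ (exp_pos u)

/-- The class is stable under inversion of the variable and multiplication by powers of it, both
of which occur in the modular transformation of the theta values. -/
lemma StrictLogConcaveExp.rpow_mul_inv {g : ℝ → ℝ} (hg : StrictLogConcaveExp g) (r : ℝ) :
    StrictLogConcaveExp fun x ↦ x ^ r * g x⁻¹ where
  pos x hx := mul_pos (rpow_pos_of_pos hx r) (hg.pos _ (inv_pos.2 hx))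
  differentiableAt x hx := (differentiableAt_id.rpow_const (Or.inl hx.ne')).mul
    ((hg.differentiableAt _ (inv_pos.2 hx)).comp x (differentiableAt_inv hx.ne'))
  strictConcave := by
    have h (u : ℝ) : log (exp u ^ r * g (exp u)⁻¹) = r * u + log (g (exp (-u))) := by
      rw [log_mul (by positivity) (hg.pos _ (by positivity)).ne', log_rpow (exp_pos u), log_exp,
        exp_neg]
    simp only [h]
    refine ⟨convex_univ, fun x _ y _ hxy a b ha hb hab ↦ ?_⟩
    have := hg.strictConcave.2 (Set.mem_univ (-x)) (Set.mem_univ (-y))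
      (fun e ↦ hxy (neg_injective e)) ha hb hab
    simp only [smul_eq_mul] at this ⊢
    rw [show -(a * x + b * y) = a * -x + b * -y by ring]
    linarith

/-- A positive differentiable limit of partial products belongs to the class when the logarithm of
each factor is strictly concave in the multiplicative variable. -/
lemma StrictLogConcaveExp.of_tendsto_prod {g : ℝ → ℝ} (hpos : ∀ x > 0, 0 < g x)
    (hd : ∀ x > 0, DifferentiableAt ℝ g x) {φ : ℕ → ℝ → ℝ} (hφ : ∀ n, ∀ x > 0, 0 < φ n x)
    (hc : ∀ n, StrictConcaveOn ℝ Set.univ fun u ↦ log (φ n (exp u)))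
    (hlim : ∀ x > 0, Tendsto (fun N ↦ ∏ n ∈ Finset.range N, φ n x) atTop (𝓝 (g x))) :
    StrictLogConcaveExp g where
  pos := hpos
  differentiableAt := hd
  strictConcave := by
    refine strictConcaveOn_of_tendsto_sum hc fun u ↦ ?_
    refine ((hlim _ (exp_pos u)).log (hpos _ (exp_pos u)).ne').congr fun N ↦ ?_
    exact log_prod fun n _ ↦ (hφ n _ (exp_pos u)).ne'

lemma StrictLogConcaveExp.differentiable_log {g : ℝ → ℝ} (hg : StrictLogConcaveExp g) :
    Differentiable ℝ fun u ↦ log (g (exp u)) := fun u ↦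
  ((hg.differentiableAt _ (exp_pos u)).comp u (Real.differentiableAt_exp)).log
    (hg.pos _ (exp_pos u)).ne'

/-- The products over stretched arguments have their unique critical point, a strict maximum, at
`t = 0`. -/
theorem StrictLogConcaveExp.prod_maximal {g : ℝ → ℝ} (hg : StrictLogConcaveExp g) {d : ℕ} {α : ℝ}
    (hα : 0 < α) {c : Fin d → ℝ} (hc : ∀ i, 0 < c i) (hprod : ∏ i, c i = 1)
    (hne : ¬ ∀ i, c i = 1) {f : ℝ → ℝ} (hf : ∀ t, f t = ∏ i, g (c i ^ t * α)) :
    Differentiable ℝ f ∧ deriv f 0 = 0 ∧ (∀ t < 0, 0 < deriv f t) ∧ (∀ t > 0, deriv f t < 0) ∧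
      (∀ t ≠ 0, f t < f 0) ∧ (∀ s, IsLocalMax f s → s = 0) := by
  set h : ℝ → ℝ := fun u ↦ log (g (exp u)) with hh
  set l : Fin d → ℝ := fun i ↦ log (c i) with hl
  have hlsum : ∑ i, l i = 0 := by
    rw [hl, ← log_prod fun i _ ↦ (hc i).ne', hprod, log_one]
  obtain ⟨j, hj⟩ : ∃ j, l j ≠ 0 := by
    by_contra! hcon
    refine hne fun i ↦ ?_
    rw [← exp_log (hc i)]
    simp only [hl] at hcon
    rw [hcon i, exp_zero]
  have harg (i : Fin d) (t : ℝ) : c i ^ t * α = exp (t * l i + log α) := by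
    rw [exp_add, exp_log hα, rpow_def_of_pos (hc i), mul_comm t]
  have hfe : f = fun t ↦ exp (∑ i, h (t * l i + log α)) := by
    funext t
    rw [hf, exp_sum]
    refine Finset.prod_congr rfl fun i _ ↦ ?_
    rw [harg, hh, exp_log (hg.pos _ (exp_pos _))]
  have hanti : StrictAnti (deriv h) := by
    have := hg.strictConcave.strictAntiOn_deriv fun x _ ↦ hg.differentiable_log x
    exact strictAntiOn_univ.1 this
  have hd (t : ℝ) : HasDerivAt f (f t * ∑ i, deriv h (t * l i + log α) * l i) t := by
    have h1 (i : Fin d) : HasDerivAt (fun t ↦ h (t * l i + log α))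
        (deriv h (t * l i + log α) * l i) t := by
      have h2 : HasDerivAt (fun t ↦ t * l i + log α) (l i) t := by
        simpa using ((hasDerivAt_id t).mul_const (l i)).add_const (log α)
      exact (hg.differentiable_log _).hasDerivAt.comp t h2
    have := (HasDerivAt.fun_sum fun i (_ : i ∈ Finset.univ) ↦ h1 i).exp
    rwa [hfe]
  have hpos (t : ℝ) : 0 < f t := by rw [hfe]; exact exp_pos _
  -- Since the weights sum to zero, `deriv h` may be centred at its value for `t = 0`; then
  -- strict monotonicity fixes the sign of every summand.
  have hcenter (t : ℝ) : ∑ i, deriv h (t * l i + log α) * l i =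
      ∑ i, (deriv h (t * l i + log α) - deriv h (log α)) * l i := by
    simp only [sub_mul, Finset.sum_sub_distrib]
    rw [← Finset.mul_sum, hlsum, mul_zero, sub_zero]
  have hzero : deriv f 0 = 0 := by
    rw [(hd 0).deriv, hcenter]
    simp
  have hneg : ∀ t > 0, deriv f t < 0 := by
    intro t ht
    rw [(hd t).deriv, hcenter]
    refine mul_neg_of_pos_of_neg (hpos t) ?_
    have hterm (i : Fin d) (hi : l i ≠ 0) :
        (deriv h (t * l i + log α) - deriv h (log α)) * l i < 0 := by
      rcases lt_or_gt_of_ne hi with hi | hi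
      · have := hanti (show t * l i + log α < log α by nlinarith)
        nlinarith
      · have := hanti (show log α < t * l i + log α by nlinarith)
        nlinarith
    refine Finset.sum_neg' (fun i _ ↦ ?_) ⟨j, Finset.mem_univ j, hterm j hj⟩
    by_cases hi : l i = 0
    · simp [hi]
    · exact (hterm i hi).le
  have hpos' : ∀ t < 0, 0 < deriv f t := by
    intro t ht
    rw [(hd t).deriv, hcenter]
    refine mul_pos (hpos t) ?_
    have hterm (i : Fin d) (hi : l i ≠ 0) :
        0 < (deriv h (t * l i + log α) - deriv h (log α)) * l i := by
      rcases lt_or_gt_of_ne hi with hi | hi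
      · have := hanti (show log α < t * l i + log α by nlinarith)
        nlinarith
      · have := hanti (show t * l i + log α < log α by nlinarith)
        nlinarith
    refine Finset.sum_pos' (fun i _ ↦ ?_) ⟨j, Finset.mem_univ j, hterm j hj⟩
    by_cases hi : l i = 0
    · simp [hi]
    · exact (hterm i hi).le
  have hdiff : Differentiable ℝ f := fun t ↦ (hd t).differentiableAt
  refine ⟨hdiff, hzero, hpos', hneg, fun t ht ↦ ?_, fun s hs ↦ ?_⟩
  · rcases lt_or_gt_of_ne ht with ht | ht
    · refine strictMonoOn_of_deriv_pos (convex_Iic 0) hdiff.continuous.continuousOn (fun x hx ↦ ?_)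
        ht.le Set.self_mem_Iic ht
      rw [interior_Iic] at hx
      exact hpos' x hx
    · refine strictAntiOn_of_deriv_neg (convex_Ici 0) hdiff.continuous.continuousOn (fun x hx ↦ ?_)
        Set.self_mem_Ici ht.le ht
      rw [interior_Ici] at hx
      exact hneg x hx
  · by_contra hs0
    have h0 := hs.deriv_eq_zero
    rcases lt_or_gt_of_ne hs0 with hlt | hlt
    · exact (hpos' s hlt).ne' h0
    · exact (hneg s hlt).ne h0

/-! ### Theta values on the positive half-line -/

lemma hasSum_theta2 {x : ℝ} (hx : 0 < x) :
    HasSum (fun k : ℤ ↦ exp (-π * ((k : ℝ) + 1 / 2) ^ 2 * x)) (theta2 x) :=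
  (hasSum_int_evenKernel (1 / 2) hx).summable.hasSum

lemma hasSum_theta3 {x : ℝ} (hx : 0 < x) :
    HasSum (fun k : ℤ ↦ exp (-π * (k : ℝ) ^ 2 * x)) (theta3 x) := by
  have := (hasSum_int_evenKernel 0 hx).summable
  simp only [add_zero] at this
  exact this.hasSum

lemma theta2_eq_evenKernel {x : ℝ} (hx : 0 < x) :
    theta2 x = evenKernel ((1 / 2 : ℝ) : UnitAddCircle) x :=
  (hasSum_int_evenKernel (1 / 2) hx).tsum_eq

lemma theta3_eq_evenKernel {x : ℝ} (hx : 0 < x) : theta3 x = evenKernel 0 x := by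
  simpa [theta3] using (hasSum_int_evenKernel 0 hx).tsum_eq

lemma theta4_eq_cosKernel {x : ℝ} (hx : 0 < x) :
    theta4 x = cosKernel ((1 / 2 : ℝ) : UnitAddCircle) x := by
  have h := (hasSum_int_cosKernel (1 / 2) hx).tsum_eq
  rw [← Complex.ofReal_inj, ← h, theta4, Complex.ofReal_tsum]
  refine tsum_congr fun k ↦ ?_
  have : Complex.exp (2 * π * Complex.I * ((1 / 2 : ℝ) : ℂ) * k) = (-1) ^ k := by
    rw [← Complex.exp_pi_mul_I, ← Complex.exp_int_mul]
    congr 1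
    push_cast
    ring
  rw [this]
  push_cast
  rfl

lemma theta2_inv {x : ℝ} (hx : 0 < x) : theta2 x = x ^ (-1 / 2 : ℝ) * theta4 x⁻¹ := by
  rw [theta2_eq_evenKernel hx, theta4_eq_cosKernel (inv_pos.2 hx), evenKernel_functional_equation,
    neg_div, rpow_neg hx.le, one_div, one_div x]

lemma theta3_inv {x : ℝ} (hx : 0 < x) : theta3 x = x ^ (-1 / 2 : ℝ) * theta3 x⁻¹ := by
  conv_lhs => rw [theta3_eq_evenKernel hx, evenKernel_functional_equation]
  rw [theta3_eq_evenKernel (inv_pos.2 hx), evenKernel_eq_cosKernel_of_zero,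
    neg_div, rpow_neg hx.le, one_div, one_div x]

lemma theta2_pos {x : ℝ} (hx : 0 < x) : 0 < theta2 x :=
  (hasSum_theta2 hx).summable.tsum_pos (fun _ ↦ (exp_pos _).le) 0 (exp_pos _)

lemma theta3_pos {x : ℝ} (hx : 0 < x) : 0 < theta3 x :=
  (hasSum_theta3 hx).summable.tsum_pos (fun _ ↦ (exp_pos _).le) 0 (exp_pos _)

/-- The alternating sum is positive because the modular transformation turns it into the sum
`θ₂` of positive terms. -/
lemma theta4_pos {x : ℝ} (hx : 0 < x) : 0 < theta4 x := by
  have h := theta2_pos (inv_pos.2 hx)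
  rw [theta2_inv (inv_pos.2 hx), inv_inv] at h
  exact pos_of_mul_pos_right h (rpow_nonneg (inv_pos.2 hx).le _)

lemma differentiableAt_cosKernel (a : ℝ) {x : ℝ} (hx : 0 < x) :
    DifferentiableAt ℝ (cosKernel (a : UnitAddCircle)) x := by
  have h1 : DifferentiableAt ℂ (fun w : ℂ ↦ jacobiTheta₂ a (Complex.I * w)) (x : ℂ) :=
    (differentiableAt_jacobiTheta₂_snd (a : ℂ) (τ := Complex.I * x) (by simpa)).comp (x : ℂ)
      (differentiableAt_id.const_mul Complex.I)
  have h2 := h1.hasDerivAt.real_of_complex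
  refine h2.differentiableAt.congr_of_eventuallyEq (.of_forall fun y ↦ ?_)
  simp only
  rw [← cosKernel_def, Complex.ofReal_re]

lemma differentiableAt_theta3 {x : ℝ} (hx : 0 < x) : DifferentiableAt ℝ theta3 x := by
  refine (differentiableAt_cosKernel 0 hx).congr_of_eventuallyEq
    ((lt_mem_nhds hx).mono fun y hy ↦ ?_)
  rw [theta3_eq_evenKernel hy, evenKernel_eq_cosKernel_of_zero]
  rfl

lemma differentiableAt_theta4 {x : ℝ} (hx : 0 < x) : DifferentiableAt ℝ theta4 x :=
  (differentiableAt_cosKernel (1 / 2) hx).congr_of_eventuallyEq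
    ((lt_mem_nhds hx).mono fun _ hy ↦ theta4_eq_cosKernel hy)

/-! ### Product formulas and strict log-concavity of the theta values -/

lemma exp_neg_pi_sq_mul (x : ℝ) (k : ℤ) :
    exp (-π * (k : ℝ) ^ 2 * x) = exp (-(π * x)) ^ (k ^ 2) := by
  rw [← rpow_intCast, ← exp_mul]
  congr 1
  push_cast
  ring

lemma exp_pow_eq_exp_neg_mul (x : ℝ) (n : ℕ) :
    exp (-(π * x)) ^ n = exp (-(n * π * x)) := by
  rw [← exp_nat_mul]
  congr 1
  ring

/-- The Jacobi product `θ₃ = ∏ (1 - q^{2m+2}) (1 + q^{2m+1})²` with `q = e^{-πx}`. -/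
lemma tendsto_prod_theta3 {x : ℝ} (hx : 0 < x) :
    Tendsto (fun N ↦ ∏ m ∈ Finset.range N, ((1 - exp (-(((2 * m + 2 : ℕ) : ℝ) * π * x))) *
      (1 + exp (-(((2 * m + 1 : ℕ) : ℝ) * π * x))) ^ 2)) atTop (𝓝 (theta3 x)) := by
  have hs : Summable fun j : ℤ ↦ exp (-(π * x)) ^ (j ^ 2) := by
    simpa only [exp_neg_pi_sq_mul] using (hasSum_theta3 hx).summable
  have := tendsto_prod_tripleProduct (z := 1) (exp_pos _)
    (exp_lt_one_iff.2 (neg_lt_zero.2 (mul_pos pi_pos hx))) (one_pow 2) hs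
  simp only [one_zpow, one_mul, ← exp_neg_pi_sq_mul] at this
  rw [theta3]
  simpa only [← exp_pow_eq_exp_neg_mul, ← pow_mul, mul_add, mul_one] using this

/-- The Jacobi product `θ₄ = ∏ (1 - q^{2m+2}) (1 - q^{2m+1})²` with `q = e^{-πx}`. -/
lemma tendsto_prod_theta4 {x : ℝ} (hx : 0 < x) :
    Tendsto (fun N ↦ ∏ m ∈ Finset.range N, ((1 - exp (-(((2 * m + 2 : ℕ) : ℝ) * π * x))) *
      (1 - exp (-(((2 * m + 1 : ℕ) : ℝ) * π * x))) ^ 2)) atTop (𝓝 (theta4 x)) := by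
  have hs : Summable fun j : ℤ ↦ exp (-(π * x)) ^ (j ^ 2) := by
    simpa only [exp_neg_pi_sq_mul] using (hasSum_theta3 hx).summable
  have := tendsto_prod_tripleProduct (z := -1) (exp_pos _)
    (exp_lt_one_iff.2 (neg_lt_zero.2 (mul_pos pi_pos hx))) (by norm_num) hs
  simp only [← exp_neg_pi_sq_mul, neg_one_mul, ← sub_eq_add_neg] at this
  rw [theta4]
  simpa only [← exp_pow_eq_exp_neg_mul, ← pow_mul, mul_add, mul_one] using this

lemma one_sub_exp_pos {n : ℕ} (hn : n ≠ 0) {x : ℝ} (hx : 0 < x) :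
    0 < 1 - exp (-((n : ℝ) * π * x)) := by
  have : 0 < (n : ℝ) := by positivity
  exact sub_pos.2 (exp_lt_one_iff.2 (neg_lt_zero.2 (by positivity)))

lemma strictConcaveOn_log_one_sub_exp_nat {n : ℕ} (hn : n ≠ 0) :
    StrictConcaveOn ℝ Set.univ fun u ↦ log (1 - exp (-((n : ℝ) * π * exp u))) :=
  strictConcaveOn_log_one_sub_exp (a := n * π) (by positivity)

lemma strictLogConcaveExp_theta4 : StrictLogConcaveExp theta4 := by
  refine .of_tendsto_prod (fun x ↦ theta4_pos) (fun x ↦ differentiableAt_theta4)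
    (fun n x hx ↦ ?_) (fun n ↦ ?_) (fun x ↦ tendsto_prod_theta4)
  · exact mul_pos (one_sub_exp_pos (by omega) hx) (pow_pos (one_sub_exp_pos (by omega) hx) 2)
  · have h1 := strictConcaveOn_log_one_sub_exp_nat (n := 2 * n + 2) (by omega)
    have h2 := strictConcaveOn_log_one_sub_exp_nat (n := 2 * n + 1) (by omega)
    refine Eq.subst (motive := StrictConcaveOn ℝ Set.univ) (funext fun u ↦ Eq.symm ?_)
      (h1.add (h2.add h2))
    rw [log_mul (one_sub_exp_pos (by omega) (exp_pos u)).ne'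
      (pow_pos (one_sub_exp_pos (by omega) (exp_pos u)) 2).ne', log_pow]
    simp only [Pi.add_apply]
    push_cast
    ring

/-- Dividing the Jacobi products cancels the even factors and leaves the squares of
`(1 - q^{2m+1}) / (1 + q^{2m+1}) = tanh ((2m+1) π x / 2)`. -/
lemma strictLogConcaveExp_theta4_div_theta3 :
    StrictLogConcaveExp fun x ↦ theta4 x / theta3 x := by
  refine .of_tendsto_prod (fun x hx ↦ div_pos (theta4_pos hx) (theta3_pos hx))
    (fun x hx ↦ (differentiableAt_theta4 hx).div (differentiableAt_theta3 hx) (theta3_pos hx).ne')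
    (φ := fun n x ↦ ((1 - exp (-(((2 * n + 1 : ℕ) : ℝ) * π * x))) /
      (1 + exp (-(((2 * n + 1 : ℕ) : ℝ) * π * x)))) ^ 2)
    (fun n x hx ↦ ?_) (fun n ↦ ?_) (fun x hx ↦ ?_)
  · exact pow_pos (div_pos (one_sub_exp_pos (by omega) hx) (by positivity)) 2
  · have h := strictConcaveOn_log_tanh (a := ((2 * n + 1 : ℕ) : ℝ) * π) (by positivity)
    refine Eq.subst (motive := StrictConcaveOn ℝ Set.univ) (funext fun u ↦ Eq.symm ?_)
      (h.add h)
    rw [log_pow, log_div (one_sub_exp_pos (by omega) (exp_pos u)).ne' (by positivity)]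
    simp only [Pi.add_apply]
    push_cast
    ring
  · refine ((tendsto_prod_theta4 hx).div (tendsto_prod_theta3 hx) (theta3_pos hx).ne').congr
      fun N ↦ ?_
    simp only [Pi.div_apply]
    rw [← Finset.prod_div_distrib]
    refine Finset.prod_congr rfl fun n _ ↦ ?_
    rw [mul_div_mul_left _ _ (one_sub_exp_pos (by omega) hx).ne', div_pow]

/-- In the product of the two Jacobi products, `(1 - q^{2m+1}) (1 + q^{2m+1}) = 1 - q^{4m+2}`, so
all factors are of the form `1 - q^n`. -/
lemma strictLogConcaveExp_theta3_mul_theta4 :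
    StrictLogConcaveExp fun x ↦ theta3 x * theta4 x := by
  refine .of_tendsto_prod (fun x hx ↦ mul_pos (theta3_pos hx) (theta4_pos hx))
    (fun x hx ↦ (differentiableAt_theta3 hx).mul (differentiableAt_theta4 hx))
    (φ := fun n x ↦ ((1 - exp (-(((2 * n + 2 : ℕ) : ℝ) * π * x))) *
      (1 - exp (-(((4 * n + 2 : ℕ) : ℝ) * π * x)))) ^ 2)
    (fun n x hx ↦ ?_) (fun n ↦ ?_) (fun x hx ↦ ?_)
  · exact pow_pos (mul_pos (one_sub_exp_pos (by omega) hx) (one_sub_exp_pos (by omega) hx)) 2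
  · have h1 := strictConcaveOn_log_one_sub_exp_nat (n := 2 * n + 2) (by omega)
    have h2 := strictConcaveOn_log_one_sub_exp_nat (n := 4 * n + 2) (by omega)
    refine Eq.subst (motive := StrictConcaveOn ℝ Set.univ) (funext fun u ↦ Eq.symm ?_)
      ((h1.add h2).add (h1.add h2))
    rw [log_pow, log_mul (one_sub_exp_pos (by omega) (exp_pos u)).ne'
      (one_sub_exp_pos (by omega) (exp_pos u)).ne']
    simp only [Pi.add_apply]
    push_cast
    ring
  · refine ((tendsto_prod_theta3 hx).mul (tendsto_prod_theta4 hx)).congr fun N ↦ ?_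
    rw [← Finset.prod_mul_distrib]
    refine Finset.prod_congr rfl fun n _ ↦ ?_
    have h : exp (-(((4 * n + 2 : ℕ) : ℝ) * π * x)) =
        exp (-(((2 * n + 1 : ℕ) : ℝ) * π * x)) ^ 2 := by
      rw [← exp_nat_mul]
      congr 1
      push_cast
      ring
    rw [h]
    ring

lemma strictLogConcaveExp_theta2 : StrictLogConcaveExp theta2 :=
  (strictLogConcaveExp_theta4.rpow_mul_inv (-1 / 2)).congr fun _ hx ↦ theta2_inv hx

lemma strictLogConcaveExp_theta2_div_theta3 :
    StrictLogConcaveExp fun x ↦ theta2 x / theta3 x := by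
  refine (strictLogConcaveExp_theta4_div_theta3.rpow_mul_inv 0).congr fun x hx ↦ ?_
  rw [theta2_inv hx, theta3_inv hx, mul_div_mul_left _ _ (rpow_pos_of_pos hx _).ne', rpow_zero,
    one_mul]

lemma strictLogConcaveExp_theta2_mul_theta3 :
    StrictLogConcaveExp fun x ↦ theta2 x * theta3 x := by
  refine (strictLogConcaveExp_theta3_mul_theta4.rpow_mul_inv (-1)).congr fun x hx ↦ ?_
  rw [theta2_inv hx, theta3_inv hx, mul_mul_mul_comm, ← rpow_add hx, mul_comm (theta4 _)]
  norm_num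

/-! ### Theta functions of stretched lattices -/

/-- A product of sums over `ℤ` is a sum over `ℤᵈ`. -/
lemma hasSum_prod_pi {d : ℕ} {f : Fin d → ℤ → ℝ} (h0 : ∀ i k, 0 ≤ f i k) {s : Fin d → ℝ}
    (hf : ∀ i, HasSum (f i) (s i)) :
    HasSum (fun k : Fin d → ℤ ↦ ∏ i, f i (k i)) (∏ i, s i) := by
  induction d with
  | zero => simp
  | succ d ih =>
    have h1 := ih (fun i k ↦ h0 i.succ k) fun i ↦ hf i.succ
    have hs : Summable fun x : ℤ × (Fin d → ℤ) ↦ f 0 x.1 * ∏ i : Fin d, f i.succ (x.2 i) :=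
      Summable.mul_of_nonneg (f := f 0) (g := fun k : Fin d → ℤ ↦ ∏ i : Fin d, f i.succ (k i))
        (hf 0).summable h1.summable (fun k ↦ h0 0 k)
        (fun k ↦ Finset.prod_nonneg fun i _ ↦ h0 i.succ (k i))
    have h2 := (hf 0).mul h1 hs
    rw [← (Fin.consEquiv fun _ ↦ ℤ).hasSum_iff, Fin.prod_univ_succ]
    refine Eq.subst (motive := fun F ↦ HasSum F _) (funext fun k ↦ Eq.symm ?_) h2
    simp [Fin.prod_univ_succ, Fin.consEquiv]

/-- The theta function of a stretched translate of the cubic lattice, with coordinates in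
`ℤ + b`, factors over the coordinates. -/
lemma thetaSet_stretch {d : ℕ} {c : Fin d → ℝ} (hc : ∀ i, 0 < c i) (t α b : ℝ) {s : Fin d → ℝ}
    (hs : ∀ i, HasSum (fun k : ℤ ↦ exp (-π * ((k : ℝ) + b) ^ 2 * (c i ^ t * α))) (s i)) :
    thetaSet (stretch c t '' {x | ∀ i, ∃ k : ℤ, x i = k + b}) α = ∏ i, s i := by
  let e : (Fin d → ℤ) → EuclideanSpace ℝ (Fin d) := fun k ↦ WithLp.toLp 2 fun i ↦ (k i : ℝ) + b
  have hst (x : EuclideanSpace ℝ (Fin d)) (i : Fin d) :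
      stretch c t x i = c i ^ (t / 2) * x i := by
    simp [stretch, Matrix.toEuclideanLin, Matrix.mulVec_diagonal]
  have hinj : Function.Injective fun k ↦ stretch c t (e k) := by
    intro k k' h
    funext i
    have := congrArg (fun x : EuclideanSpace ℝ (Fin d) ↦ x i) h
    simp only [hst, e] at this
    have := mul_left_cancel₀ (rpow_pos_of_pos (hc i) (t / 2)).ne' this
    exact_mod_cast add_right_cancel this
  have hrange : stretch c t '' {x | ∀ i, ∃ k : ℤ, x i = k + b} =
      Set.range fun k ↦ stretch c t (e k) := by
    ext y
    constructor
    · rintro ⟨x, hx, rfl⟩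
      choose k hk using hx
      refine ⟨k, congrArg _ ?_⟩
      ext i
      exact (hk i).symm
    · rintro ⟨k, rfl⟩
      exact ⟨e k, fun i ↦ ⟨k i, rfl⟩, rfl⟩
  rw [thetaSet, hrange, tsum_range (g := fun k ↦ stretch c t (e k))
    (fun p ↦ exp (-π * α * ‖p‖ ^ 2)) hinj, ← (hasSum_prod_pi (fun _ _ ↦ (exp_pos _).le) hs).tsum_eq]
  refine tsum_congr fun k ↦ ?_
  rw [← exp_sum, EuclideanSpace.norm_sq_eq, Finset.mul_sum]
  congr 1
  refine Finset.sum_congr rfl fun i _ ↦ ?_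
  have h2 : (c i ^ (t / 2)) ^ 2 = c i ^ t := by
    rw [← rpow_natCast, ← rpow_mul (hc i).le]
    norm_num
  rw [hst, Real.norm_eq_abs, sq_abs, mul_pow, h2]
  simp only [e]
  ring

lemma thetaSet_stretch_cubicShift {d : ℕ} {c : Fin d → ℝ} (hc : ∀ i, 0 < c i) {α : ℝ} (hα : 0 < α)
    (t : ℝ) : thetaSet (stretch c t '' cubicShift d) α = U2 c α t :=
  thetaSet_stretch hc t α (1 / 2) fun i ↦ hasSum_theta2 (mul_pos (rpow_pos_of_pos (hc i) t) hα)

lemma thetaSet_stretch_cubic {d : ℕ} {c : Fin d → ℝ} (hc : ∀ i, 0 < c i) {α : ℝ} (hα : 0 < α)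
    (t : ℝ) : thetaSet (stretch c t '' cubic d) α = U3 c α t := by
  have := thetaSet_stretch hc t α 0 (s := fun i ↦ theta3 (c i ^ t * α)) fun i ↦ by
    simpa only [add_zero] using hasSum_theta3 (mul_pos (rpow_pos_of_pos (hc i) t) hα)
  simp only [add_zero] at this
  exact this

end ThetaProducts

theorem theorem1p4 (d : ℕ) (hd : 1 ≤ d) (α : ℝ) (hα : 0 < α) (c : Fin d → ℝ)
    (hc : ∀ i, 0 < c i) (hprod : ∏ i, c i = 1) (hne : ¬ ∀ i, c i = 1) :
    (∀ t : ℝ,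
      ThetaProducts.U2 c α t
        = ThetaProducts.thetaSet (ThetaProducts.stretch c t '' ThetaProducts.cubicShift d) α ∧
      ThetaProducts.Q c α t
        = ThetaProducts.thetaSet (ThetaProducts.stretch c t '' ThetaProducts.cubicShift d) α
          / ThetaProducts.thetaSet (ThetaProducts.stretch c t '' ThetaProducts.cubic d) α ∧
      ThetaProducts.thetaSet (ThetaProducts.stretch c t '' ThetaProducts.cubic d) α ≠ 0 ∧
      ThetaProducts.P34 c α t = ThetaProducts.U3 c α t * ThetaProducts.U4 c α t ∧
      ThetaProducts.P23 c α t = ThetaProducts.U2 c α t * ThetaProducts.U3 c α t) ∧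
    ∀ f ∈ ({ThetaProducts.U4 c α, ThetaProducts.U2 c α, ThetaProducts.Q c α,
        ThetaProducts.P34 c α, ThetaProducts.P23 c α} : Set (ℝ → ℝ)),
      Differentiable ℝ f ∧
      deriv f 0 = 0 ∧
      (∀ t < 0, 0 < deriv f t) ∧
      (∀ t > 0, deriv f t < 0) ∧
      (∀ t ≠ 0, f t < f 0) ∧
      (∀ s, IsLocalMax f s → s = 0) := by
  constructor
  · intro t
    rw [ThetaProducts.thetaSet_stretch_cubicShift hc hα, ThetaProducts.thetaSet_stretch_cubic hc hα]
    exact ⟨rfl, Finset.prod_div_distrib _ _, Finset.prod_ne_zero_iff.2 fun i _ ↦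
      (ThetaProducts.theta3_pos (mul_pos (rpow_pos_of_pos (hc i) t) hα)).ne',
      Finset.prod_mul_distrib, Finset.prod_mul_distrib⟩
  · rintro f (rfl | rfl | rfl | rfl | rfl)
    · exact ThetaProducts.strictLogConcaveExp_theta4.prod_maximal hα hc hprod hne fun _ ↦ rfl
    · exact ThetaProducts.strictLogConcaveExp_theta2.prod_maximal hα hc hprod hne fun _ ↦ rfl
    · exact ThetaProducts.strictLogConcaveExp_theta2_div_theta3.prod_maximal hα hc hprod hne
        fun _ ↦ rfl
    · exact ThetaProducts.strictLogConcaveExp_theta3_mul_theta4.prod_maximal hα hc hprod hne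
        fun _ ↦ rfl
    · exact ThetaProducts.strictLogConcaveExp_theta2_mul_theta3.prod_maximal hα hc hprod hne
        fun _ ↦ rfl
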